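/- Let $L \ge 2$. For $p \in \mathbb{R}_{++}^L$ and $m \ge 0$ let $B(p,m) = \{q \in \mathbb{R}_+^L : p\cdot q \le m\}$. A purchase dataset with $T$ observations is a point $D = (q^t,p^t)_{t\le T}$ of $\big((\mathbb{R}_+^L\setminus\{0\})\times\mathbb{R}_{++}^L\big)^T$. A function $U : \mathbb{R}_+^L \to \mathbb{R}$ rationalizes $D$ if $U(q^t)\ge U(q)$ for all $t$ and all $q\in B(p^t,p^t\cdot q^t)$, and, for $e=(e_1,\dots,e_T) \in [0,1]^T$, it $e$-rationalizes $D$ if $U(q^t)\ge U(q)$ for all $t$ and all $q\in B(p^t,e_t\,p^t\cdot q^t)$. Let $\mathcal{U}_{WB}$ be the set of continuous $U:\mathbb{R}_+^L\to\mathbb{R}$ with $U(q)>U(q')$ whenever $q\ge q'$ and $q\ne q'$. Call $D$ rationalizable if some $U \in \mathcal{U}_{WB}$ rationalizes it. A goodness-of-fit index for $\mathcal{U}_{WB}$ is a map $\tau\ge 0$ on purchase datasets with $\tau(D)=0$ for all rationalizable $D$. It is accurate if $\tau(D)=0$ holds exactly when $D$ is rationalizable, and continuous if for each $T$ it is a continuous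 function of $(q^t,p^t)_{t\le T}$. For a loss function $Q(U;D)$ consider the index $\tau(D)=\inf_{U\in\mathcal{U}_{WB}}Q(U;D)$, in the following cases. (1) Afriat: $Q(U;D) = 1-\sup\{e\in[0,1] : U \text{ } (e,\dots,e)\text{-rationalizes } D\}$. (2) Varian: $Q(U;D)=\inf\{f_T(e) : e\in[0,1]^T,\ U\ e\text{-rationalizes } D\}$, where for each $T$ the function $f_T:[0,1]^T\to\mathbb{R}_+$ is continuous, is decreasing ($e\ge e'$ and $e \neq e'$ imply $f_T(e)<f_T(e')$), and vanishes exactly at $(1,\dots,1)$. (3) Swaps: $Q(U;D)=\sum_{t=1}^T\mu\{q\in B(p^t,p^t\cdot q^t): U(q)>U(q^t)\}$, with $\mu$ the Lebesgue measure on $\mathbb{R}^L$. (4) Nonlinear least squares: $Q(U;D)=\inf\sum_{t=1}^T (q^t-\tilde q^t)'W_D^t(q^t-\tilde q^t)$, the infimum being over all purchase datasets $(\tilde q^t,p^t)_{t\le T}$ that $U$ rationalizes and that satisfy $\tilde q^t\in B(p^t,p^t\cdot q^t)$ for all $t$, where each $W_D^t$ is a positive definite $L\times L$ matrix whose entries are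 continuous in $D$ (for each $T$ and $t$). (5) Houtman-Maks: $Q(U;D)=\min\{|\mathcal{T}| : \mathcal{T}\subseteq\{1,\dots,T\},\ U \text{ rationalizes } (q^t,p^t)_{t\notin\mathcal{T}}\}$, where every $U$ rationalizes the empty dataset. All five are goodness-of-fit indices for $\mathcal{U}_{WB}$. The Afriat index, the Varian index (for every choice of the functions $f_T$), the Swaps index and the nonlinear least-squares index (for every choice of the matrices $W_D^t$) are continuous but not accurate for $\mathcal{U}_{WB}$. The Houtman-Maks index is accurate for $\mathcal{U}_{WB}$ but not continuous. -/

import Mathlib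

open MeasureTheory
open scoped Matrix

noncomputable section

namespace RevealedPreference

/-- The linear budget set `B(p, m)`: nonnegative bundles that cost at most `m` at prices `p`. -/
def budget {L : ℕ} (p : Fin L → ℝ) (m : ℝ) : Set (Fin L → ℝ) :=
  {q | 0 ≤ q ∧ p ⬝ᵥ q ≤ m}

/-- Purchased bundles: nonnegative and nonzero vectors. -/
abbrev Bundle (L : ℕ) : Type := {q : Fin L → ℝ // 0 ≤ q ∧ q ≠ 0}

/-- Price vectors: all coordinates are strictly positive. -/
abbrev Price (L : ℕ) : Type := {p : Fin L → ℝ // ∀ i, 0 < p i}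

/-- Purchase datasets with `T` observations of `L` goods, with the product topology. -/
abbrev Dataset (L T : ℕ) : Type := Fin T → Bundle L × Price L

/-- The bundle bought in observation `t`. -/
abbrev Dataset.q {L T : ℕ} (D : Dataset L T) (t : Fin T) : Fin L → ℝ := (D t).1.1

/-- The prices in observation `t`. -/
abbrev Dataset.p {L T : ℕ} (D : Dataset L T) (t : Fin T) : Fin L → ℝ := (D t).2.1

/-- The expenditure in observation `t`. -/
abbrev Dataset.m {L T : ℕ} (D : Dataset L T) (t : Fin T) : ℝ := D.p t ⬝ᵥ D.q t

/-- Utility functions. Only their values on the nonnegative orthant are ever used, so this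
represents functions from the nonnegative orthant to the reals. -/
abbrev Utility (L : ℕ) : Type := (Fin L → ℝ) → ℝ

/-- The class of well-behaved utilities: continuous and increasing on the nonnegative orthant,
where increasing means that `q' ≤ q` and `q' ≠ q` imply `U q' < U q`. -/
def wellBehaved (L : ℕ) : Set (Utility L) :=
  {U | ContinuousOn U {q | 0 ≤ q} ∧ StrictMonoOn U {q | 0 ≤ q}}

/-- `U` rationalizes the dataset. -/
def Rationalizes {L T : ℕ} (U : Utility L) (D : Dataset L T) : Prop :=
  ∀ t, ∀ q ∈ budget (D.p t) (D.m t), U q ≤ U (D.q t)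

/-- `U` rationalizes the dataset with efficiency vector `e`. -/
def EffRationalizes {L T : ℕ} (U : Utility L) (D : Dataset L T) (e : Fin T → ℝ) : Prop :=
  ∀ t, ∀ q ∈ budget (D.p t) (e t * D.m t), U q ≤ U (D.q t)

/-- A real number for each purchase dataset, of any length. -/
abbrev Index (L : ℕ) : Type := ∀ T : ℕ, Dataset L T → ℝ

/-- A real number for each utility function and each purchase dataset, of any length. -/
abbrev LossFunction (L : ℕ) : Type := ∀ T : ℕ, Utility L → Dataset L T → ℝ

/-- Goodness-of-fit indices for the class `𝒰`. -/
def IsGoodnessOfFit {L : ℕ} (𝒰 : Set (Utility L)) (τ : Index L) : Prop :=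
  (∀ (T : ℕ) (D : Dataset L T), 0 ≤ τ T D) ∧
  ∀ (T : ℕ) (D : Dataset L T), (∃ U ∈ 𝒰, Rationalizes U D) → τ T D = 0

/-- Accuracy for the class `𝒰`. -/
def IsAccurate {L : ℕ} (𝒰 : Set (Utility L)) (τ : Index L) : Prop :=
  ∀ (T : ℕ) (D : Dataset L T), τ T D = 0 ↔ ∃ U ∈ 𝒰, Rationalizes U D

/-- Continuity in the data, for each number of observations. -/
def IsContinuous {L : ℕ} (τ : Index L) : Prop :=
  ∀ T : ℕ, Continuous (τ T)

/-- The index generated by a loss function on the class `𝒰`. -/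
def generatedIndex {L : ℕ} (𝒰 : Set (Utility L)) (Q : LossFunction L) : Index L :=
  fun T D => ⨅ U : 𝒰, Q T U.1 D

/-- The Afriat loss function. -/
def afriatLoss (L : ℕ) : LossFunction L := fun T U D =>
  1 - sSup {e : ℝ | e ∈ Set.Icc (0 : ℝ) 1 ∧ EffRationalizes U D (fun _ : Fin T => e)}

/-- The functions that aggregate the efficiency vectors in the Varian loss function, one for each
number of observations: nonnegative, continuous and decreasing on `[0,1]^T`, and zero exactly at
`(1, …, 1)`. -/
structure IsAggregator (f : ∀ T : ℕ, (Fin T → ℝ) → ℝ) : Prop where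
  nonneg : ∀ T, ∀ e ∈ Set.Icc (0 : Fin T → ℝ) 1, 0 ≤ f T e
  continuousOn : ∀ T, ContinuousOn (f T) (Set.Icc (0 : Fin T → ℝ) 1)
  strictAntiOn : ∀ T, StrictAntiOn (f T) (Set.Icc (0 : Fin T → ℝ) 1)
  eq_zero_iff : ∀ T, ∀ e ∈ Set.Icc (0 : Fin T → ℝ) 1, f T e = 0 ↔ e = 1

/-- The Varian loss function with aggregators `f`. -/
def varianLoss (L : ℕ) (f : ∀ T : ℕ, (Fin T → ℝ) → ℝ) : LossFunction L := fun T U D =>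
  sInf {r : ℝ | ∃ e ∈ Set.Icc (0 : Fin T → ℝ) 1, EffRationalizes U D e ∧ r = f T e}

/-- The Swaps loss function. -/
def swapsLoss (L : ℕ) : LossFunction L := fun _ U D =>
  ∑ t, (volume : Measure (Fin L → ℝ)).real {q | q ∈ budget (D.p t) (D.m t) ∧ U (D.q t) < U q}

/-- The weighting matrices of the least-squares loss function, one for each dataset and each
observation: positive definite, with entries that are continuous in the data. -/
structure IsWeighting {L : ℕ}
    (W : ∀ T : ℕ, Dataset L T → Fin T → Matrix (Fin L) (Fin L) ℝ) : Prop where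
  posDef : ∀ (T : ℕ) (D : Dataset L T) (t : Fin T), (W T D t).PosDef
  continuous : ∀ (T : ℕ) (t : Fin T) (i j : Fin L),
    Continuous fun D : Dataset L T => W T D t i j

/-- The nonlinear least-squares loss function with weighting matrices `W`. -/
def leastSquaresLoss (L : ℕ)
    (W : ∀ T : ℕ, Dataset L T → Fin T → Matrix (Fin L) (Fin L) ℝ) : LossFunction L :=
  fun T U D => sInf {r : ℝ | ∃ D' : Dataset L T, (∀ t, D'.p t = D.p t) ∧ Rationalizes U D' ∧
    (∀ t, D'.q t ∈ budget (D.p t) (D.m t)) ∧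
    r = ∑ t, (D.q t - D'.q t) ⬝ᵥ (W T D t *ᵥ (D.q t - D'.q t))}

/-- The Houtman-Maks loss function: the least number of observations to be removed so that `U`
rationalizes the remaining ones. -/
def houtmanMaksLoss (L : ℕ) : LossFunction L := fun T U D =>
  sInf {r : ℝ | ∃ S : Finset (Fin T),
    (∀ t, t ∉ S → ∀ q ∈ budget (D.p t) (D.m t), U q ≤ U (D.q t)) ∧ r = S.card}

/-- The Afriat index for the class `𝒰`. -/
def afriatIndex {L : ℕ} (𝒰 : Set (Utility L)) : Index L := generatedIndex 𝒰 (afriatLoss L)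

/-- The Varian index for the class `𝒰`. -/
def varianIndex {L : ℕ} (f : ∀ T : ℕ, (Fin T → ℝ) → ℝ) (𝒰 : Set (Utility L)) : Index L :=
  generatedIndex 𝒰 (varianLoss L f)

/-- The Swaps index for the class `𝒰`. -/
def swapsIndex {L : ℕ} (𝒰 : Set (Utility L)) : Index L := generatedIndex 𝒰 (swapsLoss L)

/-- The nonlinear least-squares index for the class `𝒰`. -/
def leastSquaresIndex {L : ℕ} (W : ∀ T : ℕ, Dataset L T → Fin T → Matrix (Fin L) (Fin L) ℝ)
    (𝒰 : Set (Utility L)) : Index L :=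
  generatedIndex 𝒰 (leastSquaresLoss L W)

/-- The Houtman-Maks index for the class `𝒰`. -/
def houtmanMaksIndex {L : ℕ} (𝒰 : Set (Utility L)) : Index L :=
  generatedIndex 𝒰 (houtmanMaksLoss L)

end RevealedPreference

end

open RevealedPreference

open Filter Topology

namespace RevealedPreference

variable {L T : ℕ}

/-! ### Linear costs and budget sets -/

/-! Rationalizability is not a closed condition on the data: in a limit a bundle can become just
affordable and complete a violation of the weak axiom. A continuous goodness-of-fit index vanishes
on the approaching rationalizable datasets, hence also at the limit, so it is not accurate
(`not_isAccurate_of_isContinuous`). The condition is not open either: a violation can disappear when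
two bundles merge. The Houtman-Maks loss is at least 1 whenever `U` fails, which makes its index
accurate and makes it jump at such a limit.

For continuity, a utility that fits one dataset must be replaced by one that fits a nearby dataset
almost as well. `exists_wellBehaved_of_levels` reduces the construction for three of the indices to
a choice of levels for finitely many bundles. For Afriat and Varian the old levels survive a slight
shrinking of the efficiencies, which turns weak affordability into strict affordability
(`exists_effRationalizes_of_near`). For least squares, bundles rationalized at the old prices are
multiplied by factors near 1 that grow with their rank, which puts higher-ranked bundles out of
reach at the new prices (`exists_rationalizes_rescaled`). The Swaps index is the minimum, over the
finitely many rankings of the observations, of the volume that monotonicity forces to be preferred;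
utilities close to step functions approach this volume, and it is continuous because hyperplanes are
null sets. -/

lemma dotProduct_strictMono {p : Fin L → ℝ} (hp : ∀ i, 0 < p i) :
    StrictMono fun x : Fin L → ℝ => p ⬝ᵥ x := by
  intro x y hxy
  obtain ⟨hle, i, hi⟩ := Pi.lt_def.1 hxy
  exact Finset.sum_lt_sum (fun j _ => mul_le_mul_of_nonneg_left (hle j) (hp j).le)
    ⟨i, Finset.mem_univ i, mul_lt_mul_of_pos_left hi (hp i)⟩

lemma dotProduct_pos_of_ne_zero {p x : Fin L → ℝ} (hp : ∀ i, 0 < p i) (hx : 0 ≤ x)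
    (hx0 : x ≠ 0) : 0 < p ⬝ᵥ x := by
  simpa using dotProduct_strictMono hp (lt_of_le_of_ne hx hx0.symm)

lemma mul_dotProduct_le {p p' x : Fin L → ℝ} {c : ℝ} (h : ∀ i, c * p i ≤ p' i) (hx : 0 ≤ x) :
    c * (p ⬝ᵥ x) ≤ p' ⬝ᵥ x := by
  rw [dotProduct, Finset.mul_sum]
  refine Finset.sum_le_sum fun i _ => ?_
  rw [← mul_assoc]
  exact mul_le_mul_of_nonneg_right (h i) (hx i)

lemma apply_le_div_of_mem_budget {p q : Fin L → ℝ} {m : ℝ} (hp : ∀ i, 0 < p i)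
    (hq : q ∈ budget p m) (i : Fin L) : q i ≤ m / p i := by
  rw [le_div_iff₀ (hp i), mul_comm]
  exact (Finset.single_le_sum (fun j _ => mul_nonneg (hp j).le (hq.1 j))
    (Finset.mem_univ i)).trans hq.2

lemma isCompact_budget {p : Fin L → ℝ} (hp : ∀ i, 0 < p i) (m : ℝ) : IsCompact (budget p m) := by
  refine (isCompact_Icc (a := (0 : Fin L → ℝ)) (b := fun i => m / p i)).of_isClosed_subset ?_
    fun q hq => ⟨hq.1, apply_le_div_of_mem_budget hp hq⟩
  exact (isClosed_le continuous_const continuous_id).inter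
    (isClosed_le (continuous_const.dotProduct continuous_id) continuous_const)

/-! ### Datasets -/

lemma Dataset.price_pos (D : Dataset L T) (t : Fin T) (i : Fin L) : 0 < D.p t i := (D t).2.2 i

lemma Dataset.bundle_nonneg (D : Dataset L T) (t : Fin T) : 0 ≤ D.q t := (D t).1.2.1

lemma Dataset.cost_pos (D : Dataset L T) (t s : Fin T) : 0 < D.p t ⬝ᵥ D.q s :=
  dotProduct_pos_of_ne_zero (D.price_pos t) (D.bundle_nonneg s) (D s).1.2.2

lemma Dataset.expenditure_pos (D : Dataset L T) (t : Fin T) : 0 < D.m t := D.cost_pos t t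

lemma Dataset.continuous_q (t : Fin T) : Continuous fun D : Dataset L T => D.q t :=
  continuous_subtype_val.comp (continuous_fst.comp (continuous_apply t))

lemma Dataset.continuous_p (t : Fin T) : Continuous fun D : Dataset L T => D.p t :=
  continuous_subtype_val.comp (continuous_snd.comp (continuous_apply t))

lemma Dataset.continuous_cost (t s : Fin T) :
    Continuous fun D : Dataset L T => D.p t ⬝ᵥ D.q s :=
  (Dataset.continuous_p t).dotProduct (Dataset.continuous_q s)

/-- Two datasets agree up to the factor `ρ` in all prices and in the costs of all purchased
bundles at all prices. -/
def Near (ρ : ℝ) (D D' : Dataset L T) : Prop :=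
  (∀ t s, ρ * (D.p t ⬝ᵥ D.q s) ≤ D'.p t ⬝ᵥ D'.q s ∧ ρ * (D'.p t ⬝ᵥ D'.q s) ≤ D.p t ⬝ᵥ D.q s) ∧
  ∀ t i, ρ * D.p t i ≤ D'.p t i ∧ ρ * D'.p t i ≤ D.p t i

lemma Near.symm {ρ : ℝ} {D D' : Dataset L T} (h : Near ρ D D') : Near ρ D' D :=
  ⟨fun t s => (h.1 t s).symm, fun t i => (h.2 t i).symm⟩

/-- All costs and prices are positive at `D₀`, so for `ρ < 1` the bounds hold strictly there and
persist nearby. -/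
lemma eventually_near {ρ : ℝ} (hρ : ρ < 1) (D₀ : Dataset L T) :
    ∀ᶠ D in 𝓝 D₀, Near ρ D₀ D := by
  have key : ∀ g : Dataset L T → ℝ, Continuous g → 0 < g D₀ →
      ∀ᶠ D in 𝓝 D₀, ρ * g D₀ ≤ g D ∧ ρ * g D ≤ g D₀ := by
    intro g hg h0
    have h1 : ρ * g D₀ < g D₀ := by nlinarith
    filter_upwards [hg.continuousAt.eventually (lt_mem_nhds h1),
      (continuous_const.mul hg).continuousAt.eventually (gt_mem_nhds h1)] with D ha hb
    exact ⟨ha.le, hb.le⟩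
  refine Filter.Eventually.and ?_ ?_
  · exact eventually_all.2 fun t => eventually_all.2 fun s =>
      key _ (Dataset.continuous_cost t s) (D₀.cost_pos t s)
  · exact eventually_all.2 fun t => eventually_all.2 fun i =>
      key (fun D => D.p t i) ((continuous_apply i).comp (Dataset.continuous_p t))
        (D₀.price_pos t i)

/-! ### Well-behaved utilities -/

lemma mem_wellBehaved_of_continuous {U : Utility L} (hc : Continuous U) (hm : StrictMono U) :
    U ∈ wellBehaved L :=
  ⟨hc.continuousOn, hm.strictMonoOn _⟩

lemma wellBehaved_nonempty : (wellBehaved L).Nonempty :=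
  ⟨fun x => 1 ⬝ᵥ x, mem_wellBehaved_of_continuous (continuous_const.dotProduct continuous_id)
    (dotProduct_strictMono fun _ => one_pos)⟩

instance : Nonempty (wellBehaved L) := wellBehaved_nonempty.to_subtype

lemma monotoneOn_of_mem_wellBehaved {U : Utility L} (hU : U ∈ wellBehaved L)
    {x y : Fin L → ℝ} (hx : 0 ≤ x) (hxy : x ≤ y) : U x ≤ U y :=
  hU.2.monotoneOn hx (hx.trans hxy) hxy

/-- A bundle in the interior of a budget set is strictly worse than any upper bound of the
utility on the budget set. -/
lemma lt_of_cost_lt [NeZero L] {U : Utility L} (hU : U ∈ wellBehaved L) {p : Fin L → ℝ}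
    {b v : ℝ} (h : ∀ q ∈ budget p b, U q ≤ v) {x : Fin L → ℝ} (hx : 0 ≤ x)
    (hlt : p ⬝ᵥ x < b) : U x < v := by
  -- Adding a little of every good keeps the bundle affordable and makes it strictly better.
  have hlim : Tendsto (fun c : ℝ => p ⬝ᵥ (x + c • (1 : Fin L → ℝ))) (𝓝[>] 0) (𝓝 (p ⬝ᵥ x)) := by
    have : Continuous fun c : ℝ => p ⬝ᵥ (x + c • (1 : Fin L → ℝ)) :=
      continuous_const.dotProduct (by fun_prop)
    simpa using (this.tendsto 0).mono_left nhdsWithin_le_nhds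
  obtain ⟨c, hcb, hc⟩ :=
    ((hlim.eventually (gt_mem_nhds hlt)).and self_mem_nhdsWithin).exists
  have hc : 0 < c := hc
  have hxy : x < x + c • (1 : Fin L → ℝ) :=
    Pi.lt_def.2 ⟨fun i => by simp [hc.le], 0, by simp [hc]⟩
  exact (hU.2 hx (hx.trans hxy.le) hxy).trans_le (h _ ⟨hx.trans hxy.le, hcb.le⟩)

/-- A sufficient condition for rationalizability: the bundles have utility levels `u` such that
bundles in a budget set have a lower level than the bundle purchased from it. -/
theorem exists_wellBehaved_of_levels (D : Dataset L T) (b u : Fin T → ℝ)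
    (hle : ∀ t s, D.p t ⬝ᵥ D.q s ≤ b t → u s ≤ u t)
    (hlt : ∀ t s, D.p t ⬝ᵥ D.q s < b t → u s < u t) :
    ∃ U ∈ wellBehaved L, ∀ t, ∀ q ∈ budget (D.p t) (b t), U q ≤ U (D.q t) := by
  rcases isEmpty_or_nonempty (Fin T) with hT | hT
  · obtain ⟨U, hU⟩ := wellBehaved_nonempty (L := L)
    exact ⟨U, hU, fun t => isEmptyElim t⟩
  -- For large `c` these functions of cost have slope `1 / c` below the threshold `b t` and slope
  -- `c` above it. The flat part stays above the strictly lower levels, and the steep part overtakes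
  -- any level, so their minimum over `t` is at least `u s` at each purchased bundle. On the budget
  -- set of `t` it is at most `u t`.
  have hev : ∀ᶠ c : ℝ in atTop, ∀ t s, u s ≤ u t +
      max ((D.p t ⬝ᵥ D.q s - b t) / c) (c * (D.p t ⬝ᵥ D.q s - b t)) := by
    refine eventually_all.2 fun t => eventually_all.2 fun s => ?_
    rcases lt_trichotomy (D.p t ⬝ᵥ D.q s) (b t) with h | h | h
    · have hu := hlt t s h
      filter_upwards [eventually_gt_atTop 0,
        eventually_ge_atTop ((b t - D.p t ⬝ᵥ D.q s) / (u t - u s))] with c hc0 hc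
      have : u s - u t ≤ (D.p t ⬝ᵥ D.q s - b t) / c := by
        rw [le_div_iff₀ hc0]
        rw [div_le_iff₀ (by linarith)] at hc
        linarith
      linarith [le_max_left ((D.p t ⬝ᵥ D.q s - b t) / c) (c * (D.p t ⬝ᵥ D.q s - b t))]
    · exact Eventually.of_forall fun c => by simpa [h] using hle t s h.le
    · filter_upwards [eventually_ge_atTop ((u s - u t) / (D.p t ⬝ᵥ D.q s - b t))] with c hc
      rw [div_le_iff₀ (by linarith)] at hc
      linarith [le_max_right ((D.p t ⬝ᵥ D.q s - b t) / c) (c * (D.p t ⬝ᵥ D.q s - b t))]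
  obtain ⟨c, hc, hc0⟩ := (hev.and (eventually_gt_atTop 0)).exists
  let h : Fin T → (Fin L → ℝ) → ℝ := fun t x =>
    u t + max ((D.p t ⬝ᵥ x - b t) / c) (c * (D.p t ⬝ᵥ x - b t))
  have hcont : ∀ t, Continuous (h t) := by
    intro t
    have h1 : Continuous fun x : Fin L → ℝ => D.p t ⬝ᵥ x :=
      continuous_const.dotProduct continuous_id
    exact continuous_const.add
      (((h1.sub continuous_const).div_const c).max (continuous_const.mul (h1.sub continuous_const)))
  have hmono : ∀ t, StrictMono (h t) := by
    intro t x y hxy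
    have h1 : D.p t ⬝ᵥ x < D.p t ⬝ᵥ y := dotProduct_strictMono (D.price_pos t) hxy
    exact add_lt_add_right (max_lt_max (div_lt_div_of_pos_right (by linarith) hc0)
      (mul_lt_mul_of_pos_left (by linarith) hc0)) _
  have hne : (Finset.univ : Finset (Fin T)).Nonempty := Finset.univ_nonempty
  refine ⟨fun x => Finset.univ.inf' hne fun t => h t x, mem_wellBehaved_of_continuous
    (Continuous.finset_inf'_apply hne fun t _ => hcont t) ?_, ?_⟩
  · intro x y hxy
    refine (Finset.lt_inf'_iff hne).2 fun t ht => ?_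
    exact (Finset.inf'_le _ ht).trans_lt (hmono t hxy)
  · intro t q hq
    have h1 : h t q ≤ u t := by
      have h2 : D.p t ⬝ᵥ q - b t ≤ 0 := by linarith [hq.2]
      have h3 : max ((D.p t ⬝ᵥ q - b t) / c) (c * (D.p t ⬝ᵥ q - b t)) ≤ 0 :=
        max_le (div_nonpos_of_nonpos_of_nonneg h2 hc0.le)
          (mul_nonpos_of_nonneg_of_nonpos hc0.le h2)
      simp only [h]
      linarith
    exact (Finset.inf'_le _ (Finset.mem_univ t)).trans
      (h1.trans (Finset.le_inf' hne _ fun s _ => hc s t))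

lemma exists_rationalizes_of_levels (D : Dataset L T) (u : Fin T → ℝ)
    (hle : ∀ t s, D.p t ⬝ᵥ D.q s ≤ D.m t → u s ≤ u t)
    (hlt : ∀ t s, D.p t ⬝ᵥ D.q s < D.m t → u s < u t) :
    ∃ U ∈ wellBehaved L, Rationalizes U D :=
  exists_wellBehaved_of_levels D D.m u hle hlt

/-! ### Generated indices -/

lemma isGoodnessOfFit_generatedIndex {𝒰 : Set (Utility L)} {Q : LossFunction L}
    (h0 : ∀ T U (D : Dataset L T), 0 ≤ Q T U D)
    (h1 : ∀ T (U : Utility L) (D : Dataset L T), Rationalizes U D → Q T U D ≤ 0) :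
    IsGoodnessOfFit 𝒰 (generatedIndex 𝒰 Q) := by
  refine ⟨fun T D => Real.iInf_nonneg fun U => h0 T _ D, ?_⟩
  rintro T D ⟨U, hU, hD⟩
  refine le_antisymm ?_ (Real.iInf_nonneg fun U => h0 T _ D)
  exact (ciInf_le ⟨0, by rintro _ ⟨V, rfl⟩; exact h0 T _ D⟩ (⟨U, hU⟩ : 𝒰)).trans (h1 T U D hD)

lemma generatedIndex_le_add {𝒰 : Set (Utility L)} [Nonempty 𝒰] {Q : LossFunction L}
    (h0 : ∀ T U (D : Dataset L T), 0 ≤ Q T U D) {D D' : Dataset L T} {ε : ℝ}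
    (h : ∀ U ∈ 𝒰, ∃ U' ∈ 𝒰, Q T U' D' ≤ Q T U D + ε) :
    generatedIndex 𝒰 Q T D' ≤ generatedIndex 𝒰 Q T D + ε := by
  rw [← sub_le_iff_le_add]
  refine le_ciInf fun U => ?_
  obtain ⟨U', hU', hle⟩ := h U.1 U.2
  rw [sub_le_iff_le_add]
  exact (ciInf_le ⟨0, by rintro _ ⟨V, rfl⟩; exact h0 T _ D'⟩ (⟨U', hU'⟩ : 𝒰)).trans hle

/-- A generated index is continuous if the losses on nearby datasets are nearly matched by
suitable choices of the utility. -/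
lemma isContinuous_generatedIndex {𝒰 : Set (Utility L)} [Nonempty 𝒰] {Q : LossFunction L}
    (h0 : ∀ T U (D : Dataset L T), 0 ≤ Q T U D)
    (h : ∀ T (D₀ : Dataset L T) (ε : ℝ), 0 < ε → ∀ᶠ D in 𝓝 D₀,
      (∀ U ∈ 𝒰, ∃ U' ∈ 𝒰, Q T U' D ≤ Q T U D₀ + ε) ∧
      ∀ U ∈ 𝒰, ∃ U' ∈ 𝒰, Q T U' D₀ ≤ Q T U D + ε) :
    IsContinuous (generatedIndex 𝒰 Q) := by
  refine fun T => continuous_iff_continuousAt.2 fun D₀ => Metric.tendsto_nhds.2 fun ε hε => ?_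
  filter_upwards [h T D₀ (ε / 2) (half_pos hε)] with D hD
  have h1 := generatedIndex_le_add h0 hD.1
  have h2 := generatedIndex_le_add h0 hD.2
  rw [Real.dist_eq, abs_lt]
  constructor <;> linarith

/-- `Near` is symmetric, so a one-sided comparison with `ρ` independent of the datasets gives both
inequalities. -/
lemma isContinuous_generatedIndex_of_near {𝒰 : Set (Utility L)} [Nonempty 𝒰]
    {Q : LossFunction L} (h0 : ∀ T U (D : Dataset L T), 0 ≤ Q T U D)
    (h : ∀ (T : ℕ) (ε : ℝ), 0 < ε → ∃ ρ < 1, ∀ D D' : Dataset L T, Near ρ D D' →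
      ∀ U ∈ 𝒰, ∃ U' ∈ 𝒰, Q T U' D' ≤ Q T U D + ε) :
    IsContinuous (generatedIndex 𝒰 Q) := by
  refine isContinuous_generatedIndex h0 fun T D₀ ε hε => ?_
  obtain ⟨ρ, hρ, hnear⟩ := h T ε hε
  filter_upwards [eventually_near hρ D₀] with D hD
  exact ⟨hnear _ _ hD, hnear _ _ hD.symm⟩

/-! ### Efficiency vectors -/

lemma effRationalizes_one_iff {U : Utility L} {D : Dataset L T} :
    EffRationalizes U D 1 ↔ Rationalizes U D := by
  simp [EffRationalizes, Rationalizes]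

/-- Keeps the sets of efficiencies in the Afriat and Varian losses nonempty: a budget of zero buys
only the zero bundle. -/
lemma effRationalizes_zero {U : Utility L} (hU : U ∈ wellBehaved L) (D : Dataset L T) :
    EffRationalizes U D 0 := by
  rintro t q ⟨hq0, hq⟩
  have hq' : q = 0 := by
    by_contra hne
    have := dotProduct_pos_of_ne_zero (D.price_pos t) hq0 hne
    simp only [Pi.zero_apply, zero_mul] at hq
    linarith
  subst hq'
  exact monotoneOn_of_mem_wellBehaved hU le_rfl (D.bundle_nonneg t)

/-- The levels `U (D.q t)` still work. Two factors `ρ` pay for comparing the costs and the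
expenditures of the two datasets; the third turns weak affordability in `D'` into strict
affordability in `D`. -/
lemma exists_effRationalizes_of_near [NeZero L] {ρ : ℝ} (hρ0 : 0 < ρ) (hρ1 : ρ < 1)
    {D D' : Dataset L T} (hD : Near ρ D D') {e : Fin T → ℝ} (he : e ∈ Set.Icc (0 : Fin T → ℝ) 1)
    {U : Utility L} (hU : U ∈ wellBehaved L) (hUe : EffRationalizes U D e) :
    ∃ U' ∈ wellBehaved L, EffRationalizes U' D' (ρ ^ 3 • e) := by
  have key : ∀ t s, D'.p t ⬝ᵥ D'.q s ≤ (ρ ^ 3 • e) t * D'.m t → U (D.q s) < U (D.q t) := by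
    intro t s h
    refine lt_of_cost_lt hU (hUe t) (D.bundle_nonneg s) ?_
    have h1 := (hD.1 t s).1
    have h2 := (hD.1 t t).2
    have h3 := D.cost_pos t s
    have h4 : ρ ^ 3 * (e t * D'.m t) ≤ ρ ^ 2 * (e t * D.m t) := by
      have := mul_le_mul_of_nonneg_left h2 (mul_nonneg (sq_nonneg ρ) (he.1 t))
      calc ρ ^ 3 * (e t * D'.m t) = ρ ^ 2 * e t * (ρ * D'.m t) := by ring
        _ ≤ ρ ^ 2 * e t * D.m t := this
        _ = _ := by ring
    have h5 : ρ * (D.p t ⬝ᵥ D.q s) ≤ ρ * (ρ * (e t * D.m t)) := by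
      simp only [Pi.smul_apply, smul_eq_mul, mul_assoc] at h
      nlinarith
    have h6 := le_of_mul_le_mul_left h5 hρ0
    -- The bundle has positive cost, so the efficiency budget is positive and the factor `ρ` makes a
    -- strict difference.
    have h7 : 0 < e t * D.m t := by
      by_contra! hneg
      nlinarith
    nlinarith
  exact exists_wellBehaved_of_levels D' (fun t => (ρ ^ 3 • e) t * D'.m t)
    (fun t => U (D.q t)) (fun t s h => (key t s h).le) fun t s h => key t s h.le

/-! ### The Afriat index -/

lemma afriatLoss_nonneg (T : ℕ) (U : Utility L) (D : Dataset L T) : 0 ≤ afriatLoss L T U D :=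
  by
  refine sub_nonneg.2 (Real.sSup_le ?_ zero_le_one)
  rintro e ⟨he, -⟩
  exact he.2

lemma afriatLoss_le {U : Utility L} {D : Dataset L T} {e : ℝ} (he : e ∈ Set.Icc (0 : ℝ) 1)
    (h : EffRationalizes U D fun _ => e) : afriatLoss L T U D ≤ 1 - e :=
  by
  have hbdd : BddAbove {e : ℝ | e ∈ Set.Icc (0 : ℝ) 1 ∧ EffRationalizes U D fun _ => e} :=
    ⟨1, fun _ h => h.1.2⟩
  exact sub_le_sub_left (le_csSup hbdd ⟨he, h⟩) 1

lemma isGoodnessOfFit_afriatIndex :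
    IsGoodnessOfFit (wellBehaved L) (afriatIndex (wellBehaved L)) :=
  isGoodnessOfFit_generatedIndex afriatLoss_nonneg fun T U D hD => by
    have h1 : (1 : ℝ) ∈ Set.Icc (0 : ℝ) 1 := ⟨zero_le_one, le_rfl⟩
    simpa using afriatLoss_le h1 (effRationalizes_one_iff.2 hD)

lemma exists_pow_three_close {δ : ℝ} (hδ : 0 < δ) : ∃ ρ : ℝ, 0 < ρ ∧ ρ < 1 ∧ 1 - ρ ^ 3 < δ := by
  have h : Tendsto (fun ρ : ℝ => 1 - ρ ^ 3) (𝓝[<] 1) (𝓝 0) := by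
    have : Continuous fun ρ : ℝ => 1 - ρ ^ 3 := by fun_prop
    simpa using (this.tendsto 1).mono_left nhdsWithin_le_nhds
  obtain ⟨ρ, ⟨h1, h2⟩, h3⟩ := ((h.eventually (gt_mem_nhds hδ)).and
    (mem_nhdsWithin_of_mem_nhds (lt_mem_nhds (zero_lt_one' ℝ)))).and self_mem_nhdsWithin |>.exists
  exact ⟨ρ, h2, h3, h1⟩

lemma isContinuous_afriatIndex [NeZero L] :
    IsContinuous (afriatIndex (wellBehaved L)) := by
  refine isContinuous_generatedIndex_of_near afriatLoss_nonneg fun T ε hε => ?_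
  obtain ⟨ρ, hρ0, hρ1, hρ⟩ := exists_pow_three_close (half_pos hε)
  refine ⟨ρ, hρ1, fun D D' hD U hU => ?_⟩
  have hne : {e : ℝ | e ∈ Set.Icc (0 : ℝ) 1 ∧ EffRationalizes U D fun _ => e}.Nonempty :=
    ⟨0, ⟨le_rfl, zero_le_one⟩, effRationalizes_zero hU D⟩
  obtain ⟨e, ⟨he, hUe⟩, hlt⟩ := exists_lt_of_lt_csSup hne (sub_lt_self _ (half_pos hε))
  obtain ⟨U', hU', hrat⟩ := exists_effRationalizes_of_near hρ0 hρ1 hD (e := fun _ => e)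
    ⟨fun _ => he.1, fun _ => he.2⟩ hU hUe
  have hρ3 : ρ ^ 3 ≤ 1 := pow_le_one₀ hρ0.le hρ1.le
  have hle := afriatLoss_le (e := ρ ^ 3 * e) (U := U') (D := D')
    ⟨mul_nonneg (by positivity) he.1, mul_le_one₀ hρ3 he.1 he.2⟩ hrat
  refine ⟨U', hU', hle.trans ?_⟩
  have : (1 - ρ ^ 3) * e ≤ ε / 2 := by nlinarith [he.1, he.2]
  unfold afriatLoss
  linarith

/-! ### The Varian index -/

variable {f : ∀ T : ℕ, (Fin T → ℝ) → ℝ}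

lemma varianLoss_nonneg (hf : IsAggregator f) (T : ℕ) (U : Utility L) (D : Dataset L T) :
    0 ≤ varianLoss L f T U D :=
  Real.sInf_nonneg (by rintro _ ⟨e, he, -, rfl⟩; exact hf.nonneg T e he)

lemma varianLoss_le (hf : IsAggregator f) {U : Utility L} {D : Dataset L T} {e : Fin T → ℝ}
    (he : e ∈ Set.Icc (0 : Fin T → ℝ) 1) (h : EffRationalizes U D e) :
    varianLoss L f T U D ≤ f T e :=
  csInf_le ⟨0, by rintro _ ⟨e, he, -, rfl⟩; exact hf.nonneg T e he⟩ ⟨e, he, h, rfl⟩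

lemma isGoodnessOfFit_varianIndex (hf : IsAggregator f) :
    IsGoodnessOfFit (wellBehaved L) (varianIndex f (wellBehaved L)) := by
  refine isGoodnessOfFit_generatedIndex (varianLoss_nonneg hf) fun T U D hD => ?_
  have h1 : (1 : Fin T → ℝ) ∈ Set.Icc (0 : Fin T → ℝ) 1 := ⟨zero_le_one, le_rfl⟩
  exact (varianLoss_le hf h1 (effRationalizes_one_iff.2 hD)).trans
    ((hf.eq_zero_iff T 1 h1).2 rfl).le

lemma isContinuous_varianIndex [NeZero L] (hf : IsAggregator f) :
    IsContinuous (varianIndex f (wellBehaved L)) := by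
  refine isContinuous_generatedIndex_of_near (varianLoss_nonneg hf) fun T ε hε => ?_
  -- Uniform continuity on the compact cube makes `δ` independent of the datasets and of `e`.
  obtain ⟨δ, hδ, hfδ⟩ := Metric.uniformContinuousOn_iff.1
    (isCompact_Icc.uniformContinuousOn_of_continuous (hf.continuousOn T)) _ (half_pos hε)
  obtain ⟨ρ, hρ0, hρ1, hρ⟩ := exists_pow_three_close hδ
  refine ⟨ρ, hρ1, fun D D' hD U hU => ?_⟩
  have hne : {r : ℝ | ∃ e ∈ Set.Icc (0 : Fin T → ℝ) 1, EffRationalizes U D e ∧ r = f T e}.Nonempty :=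
    ⟨_, 0, ⟨le_rfl, zero_le_one⟩, effRationalizes_zero hU D, rfl⟩
  obtain ⟨_, ⟨e, he, hUe, rfl⟩, hlt⟩ :=
    exists_lt_of_csInf_lt hne (lt_add_of_pos_right _ (half_pos hε))
  obtain ⟨U', hU', hrat⟩ := exists_effRationalizes_of_near hρ0 hρ1 hD he hU hUe
  have hρ3 : ρ ^ 3 ≤ 1 := pow_le_one₀ hρ0.le hρ1.le
  have he' : ρ ^ 3 • e ∈ Set.Icc (0 : Fin T → ℝ) 1 :=
    ⟨fun t => mul_nonneg (by positivity) (he.1 t), fun t => mul_le_one₀ hρ3 (he.1 t) (he.2 t)⟩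
  have hdist : dist (ρ ^ 3 • e) e < δ := by
    refine (dist_pi_lt_iff hδ).2 fun t => ?_
    have h0 : 0 ≤ e t := he.1 t
    have h1 : e t ≤ 1 := he.2 t
    rw [Real.dist_eq, abs_lt, Pi.smul_apply, smul_eq_mul]
    constructor <;> nlinarith
  have hclose := hfδ _ he' _ he hdist
  rw [Real.dist_eq] at hclose
  refine ⟨U', hU', (varianLoss_le hf he' hrat).trans ?_⟩
  have := (abs_lt.1 hclose).2
  unfold varianLoss
  linarith

/-! ### The nonlinear least-squares index -/

variable {W : ∀ T : ℕ, Dataset L T → Fin T → Matrix (Fin L) (Fin L) ℝ}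

/-- The weighted sum of squared deviations of the bundles `x` from the purchased bundles. -/
def weightedSquares (W : ∀ T : ℕ, Dataset L T → Fin T → Matrix (Fin L) (Fin L) ℝ)
    (D : Dataset L T) (x : Fin T → Fin L → ℝ) : ℝ :=
  ∑ t, (D.q t - x t) ⬝ᵥ (W T D t *ᵥ (D.q t - x t))

lemma weightedSquares_nonneg (hW : IsWeighting W) (D : Dataset L T) (x : Fin T → Fin L → ℝ) :
    0 ≤ weightedSquares W D x :=
  Finset.sum_nonneg fun t _ => by
    simpa using (hW.posDef T D t).posSemidef.dotProduct_mulVec_nonneg (D.q t - x t)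

lemma continuous_weightedSquares (hW : IsWeighting W) :
    Continuous fun z : Dataset L T × (Fin T → Fin L → ℝ) => weightedSquares W z.1 z.2 := by
  refine continuous_finsetSum _ fun t _ => ?_
  have h1 : Continuous fun z : Dataset L T × (Fin T → Fin L → ℝ) => z.1.q t - z.2 t :=
    ((Dataset.continuous_q t).comp continuous_fst).sub
      ((continuous_apply t).comp continuous_snd)
  have h2 : Continuous fun z : Dataset L T × (Fin T → Fin L → ℝ) => W T z.1 t :=
    continuous_matrix fun i j => (hW.continuous T t i j).comp continuous_fst
  exact h1.dotProduct (h2.matrix_mulVec h1)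

lemma leastSquaresLoss_nonneg (hW : IsWeighting W) (T : ℕ) (U : Utility L) (D : Dataset L T) :
    0 ≤ leastSquaresLoss L W T U D :=
  Real.sInf_nonneg (by rintro _ ⟨D', -, -, -, rfl⟩; exact weightedSquares_nonneg hW D D'.q)

lemma leastSquaresLoss_le (hW : IsWeighting W) {U : Utility L} {D D' : Dataset L T}
    (hp : ∀ t, D'.p t = D.p t) (hU : Rationalizes U D')
    (hb : ∀ t, D'.q t ∈ budget (D.p t) (D.m t)) :
    leastSquaresLoss L W T U D ≤ weightedSquares W D D'.q :=
  csInf_le ⟨0, by rintro _ ⟨D', -, -, -, rfl⟩; exact weightedSquares_nonneg hW D D'.q⟩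
    ⟨D', hp, hU, hb, rfl⟩

lemma isGoodnessOfFit_leastSquaresIndex (hW : IsWeighting W) :
    IsGoodnessOfFit (wellBehaved L) (leastSquaresIndex W (wellBehaved L)) := by
  refine isGoodnessOfFit_generatedIndex (leastSquaresLoss_nonneg hW) fun T U D hD => ?_
  refine (leastSquaresLoss_le hW (fun _ => rfl) hD fun t => ⟨D.bundle_nonneg t, le_rfl⟩).trans ?_
  simp [weightedSquares]

/-- Demand exists: a well-behaved utility rationalizes some dataset with given prices and with
bundles that are affordable at the given expenditures. -/
lemma exists_rationalizes_of_prices [NeZero L] {U : Utility L} (hU : U ∈ wellBehaved L)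
    (D : Dataset L T) : ∃ D' : Dataset L T, (∀ t, D'.p t = D.p t) ∧ Rationalizes U D' ∧
      ∀ t, D'.q t ∈ budget (D.p t) (D.m t) := by
  have hmax : ∀ t, ∃ x ∈ budget (D.p t) (D.m t), ∀ q ∈ budget (D.p t) (D.m t), U q ≤ U x := by
    intro t
    obtain ⟨x, hx, hmax⟩ := (isCompact_budget (D.price_pos t) (D.m t)).exists_isMaxOn
      ⟨D.q t, D.bundle_nonneg t, le_rfl⟩ (hU.1.mono fun q hq => hq.1)
    exact ⟨x, hx, fun q hq => hmax hq⟩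
  choose x hx hmax using hmax
  have hx0 : ∀ t, x t ≠ 0 := by
    intro t h0
    have := lt_of_cost_lt hU (hmax t) (hx t).1 (by simpa [h0] using D.expenditure_pos t)
    exact this.false
  refine ⟨fun t => (⟨x t, (hx t).1, hx0 t⟩, (D t).2), fun _ => rfl, fun t q hq => ?_, hx⟩
  exact hmax t q ⟨hq.1, hq.2.trans (hx t).2⟩

/-- A rationalizable dataset remains rationalizable under a small change of the prices, after a
rescaling of the bundles that makes bundles with a higher utility larger. -/
lemma exists_rationalizes_rescaled [NeZero L] {ρ : ℝ} (hρ0 : 0 < ρ) (hρ1 : ρ < 1)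
    {U : Utility L} (hU : U ∈ wellBehaved L) {D D' : Dataset L T} (hD : Rationalizes U D)
    (hp : ∀ t i, ρ * D.p t i ≤ D'.p t i ∧ ρ * D'.p t i ≤ D.p t i) :
    ∃ c : Fin T → ℝ, (∀ t, ρ ^ (3 * T) ≤ c t ∧ c t ≤ ρ ^ 3) ∧ ∃ D'' : Dataset L T,
      (∀ t, D''.p t = D'.p t) ∧ (∀ t, D''.q t = c t • D.q t) ∧
      ∃ U' ∈ wellBehaved L, Rationalizes U' D'' := by
  -- The rank of an observation by the utility of its bundle, with ties broken.
  let r : Equiv.Perm (Fin T) := (Tuple.sort fun t => U (D.q t)).symm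
  have hr : ∀ t s, r t ≤ r s → U (D.q t) ≤ U (D.q s) := by
    intro t s h
    simpa [r] using Tuple.monotone_sort (fun t => U (D.q t)) h
  -- Each step up in rank gains a factor `ρ⁻³`: two powers absorb the change of prices, one gives
  -- strictness. The ranks end at `T - 1`, so even the top bundle shrinks by `ρ ^ 3`, which later
  -- keeps it affordable in the other dataset.
  let c : Fin T → ℝ := fun t => ρ ^ (3 * (T - (r t : ℕ)))
  have hc0 : ∀ t, 0 < c t := fun t => by positivity
  have hstep : ∀ t s, r t < r s → c t ≤ ρ ^ 3 * c s := by
    intro t s h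
    have h' : (r t : ℕ) < r s := h
    simp only [c, ← pow_add]
    exact pow_le_pow_of_le_one hρ0.le hρ1.le (by omega)
  let D'' : Dataset L T := fun t =>
    (⟨c t • D.q t, smul_nonneg (hc0 t).le (D.bundle_nonneg t),
      smul_ne_zero (hc0 t).ne' (D t).1.2.2⟩, (D' t).2)
  refine ⟨c, fun t => ⟨pow_le_pow_of_le_one hρ0.le hρ1.le (by omega),
    pow_le_pow_of_le_one hρ0.le hρ1.le (by omega)⟩, D'', fun _ => rfl, fun _ => rfl, ?_⟩
  -- No observation can afford a higher-ranked bundle, so the ranks themselves serve as levels.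
  have key : ∀ t s, r t < r s → D''.m t < D''.p t ⬝ᵥ D''.q s := by
    intro t s h
    have h1 : D.p t ⬝ᵥ D.q t ≤ D.p t ⬝ᵥ D.q s := by
      by_contra! hlt
      exact (lt_of_cost_lt hU (hD t) (D.bundle_nonneg s) hlt).not_ge (hr t s h.le)
    have h2 := mul_dotProduct_le (fun i => (hp t i).1) (D.bundle_nonneg s)
    have h3 := mul_dotProduct_le (fun i => (hp t i).2) (D.bundle_nonneg t)
    have h4 : 0 < D'.p t ⬝ᵥ D.q t :=
      dotProduct_pos_of_ne_zero (D'.price_pos t) (D.bundle_nonneg t) (D t).1.2.2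
    change D'.p t ⬝ᵥ (c t • D.q t) < D'.p t ⬝ᵥ (c s • D.q s)
    rw [dotProduct_smul, dotProduct_smul, smul_eq_mul, smul_eq_mul]
    calc c t * (D'.p t ⬝ᵥ D.q t) ≤ ρ ^ 3 * c s * (D'.p t ⬝ᵥ D.q t) :=
          mul_le_mul_of_nonneg_right (hstep t s h) h4.le
      _ < ρ ^ 2 * c s * (D'.p t ⬝ᵥ D.q t) :=
          mul_lt_mul_of_pos_right (mul_lt_mul_of_pos_right
            (pow_lt_pow_right_of_lt_one₀ hρ0 hρ1 (by norm_num)) (hc0 s)) h4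
      _ = c s * (ρ * (ρ * (D'.p t ⬝ᵥ D.q t))) := by ring
      _ ≤ c s * (D'.p t ⬝ᵥ D.q s) := by
          refine mul_le_mul_of_nonneg_left (le_trans ?_ h2) (hc0 s).le
          exact mul_le_mul_of_nonneg_left (h3.trans h1) hρ0.le
  refine exists_rationalizes_of_levels D'' (fun t => ((r t : ℕ) : ℝ)) (fun t s h => ?_)
    fun t s h => ?_
  · have := mt (key t s) h.not_gt
    exact_mod_cast not_lt.1 this
  · have h1 := mt (key t s) h.not_gt
    have h2 : r s ≠ r t := fun he => by
      rw [r.injective he] at h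
      exact h.false
    exact_mod_cast lt_of_le_of_ne (not_lt.1 h1) h2

/-- Bounds on the prices and on the expenditure bound the budget set. -/
lemma eventually_budget_subset (D₀ : Dataset L T) : ∃ M : ℝ, ∀ᶠ D in 𝓝 D₀,
    ∀ t, budget (D.p t) (D.m t) ⊆ Set.Icc 0 fun _ => M := by
  have hex : ∃ M : ℝ, ∀ t i, D₀.m t / D₀.p t i < M := by
    have : ∀ᶠ M : ℝ in atTop, ∀ t i, D₀.m t / D₀.p t i < M :=
      eventually_all.2 fun t => eventually_all.2 fun i => eventually_gt_atTop _
    exact this.exists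
  obtain ⟨M, hM⟩ := hex
  refine ⟨M, ?_⟩
  have hev : ∀ᶠ D in 𝓝 D₀, ∀ t i, D.m t / D.p t i < M := by
    refine eventually_all.2 fun t => eventually_all.2 fun i => ?_
    have h1 : ContinuousAt (fun D : Dataset L T => D.m t / D.p t i) D₀ :=
      (Dataset.continuous_cost t t).continuousAt.div
        ((continuous_apply i).comp (Dataset.continuous_p t)).continuousAt (D₀.price_pos t i).ne'
    exact h1.eventually (gt_mem_nhds (hM t i))
  filter_upwards [hev] with D hD t q hq
  exact ⟨hq.1, fun i => (apply_le_div_of_mem_budget (D.price_pos t) hq i).trans (hD t i).le⟩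

/-- At `(a, a, 1)` the inequality is `G a x < G a x + ε`; compactness of `K` gives one neighbourhood
for all `x`. -/
lemma eventually_lt_add_of_rescaled {X : Type*} [TopologicalSpace X]
    {G : X → (Fin T → Fin L → ℝ) → ℝ} (hG : Continuous fun z : X × _ => G z.1 z.2) (a : X)
    {K : Set (Fin T → Fin L → ℝ)} (hK : IsCompact K) {ε : ℝ} (hε : 0 < ε) :
    ∀ᶠ z : X × X × (Fin T → ℝ) in 𝓝 (a, a, 1),
      ∀ x ∈ K, G z.2.1 (fun t => z.2.2 t • x t) < G z.1 x + ε := by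
  refine hK.eventually_forall_of_forall_eventually fun x _ => ?_
  have h1 : Continuous fun z : (X × X × (Fin T → ℝ)) × (Fin T → Fin L → ℝ) =>
      G z.1.2.1 (fun t => z.1.2.2 t • z.2 t) :=
    hG.comp ((continuous_fst.comp (continuous_snd.comp continuous_fst)).prodMk (by fun_prop))
  have h2 : Continuous fun z : (X × X × (Fin T → ℝ)) × (Fin T → Fin L → ℝ) =>
      G z.1.1 z.2 + ε :=
    (hG.comp ((continuous_fst.comp continuous_fst).prodMk continuous_snd)).add continuous_const
  refine h1.continuousAt.eventually_lt h2.continuousAt ?_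
  simpa using hε

lemma isContinuous_leastSquaresIndex [NeZero L] (hW : IsWeighting W) :
    IsContinuous (leastSquaresIndex W (wellBehaved L)) := by
  refine isContinuous_generatedIndex (leastSquaresLoss_nonneg hW) fun T D₀ ε hε => ?_
  obtain ⟨M, hM⟩ := eventually_budget_subset D₀
  have hclose := eventually_lt_add_of_rescaled (continuous_weightedSquares hW) D₀
    (isCompact_Icc (a := (0 : Fin T → Fin L → ℝ)) (b := fun _ _ => M)) (half_pos hε)
  -- Separate conditions `A`, `A'` and `C` on the old dataset, the new dataset and the scaling
  -- factors let `D₀` and `D` exchange roles.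
  rw [nhds_prod_eq, nhds_prod_eq] at hclose
  obtain ⟨A, hA, B, hB, hAB⟩ := eventually_prod_iff.1 hclose
  obtain ⟨A', hA', C, hC, hAC⟩ := eventually_prod_iff.1 hB
  obtain ⟨δ, hδ, hball⟩ := Metric.eventually_nhds_iff.1 hC
  obtain ⟨ρ, hρ0, hρ1, hρ⟩ : ∃ ρ : ℝ, 0 < ρ ∧ ρ < 1 ∧ 1 - ρ ^ (3 * T) < δ := by
    have h : Tendsto (fun ρ : ℝ => 1 - ρ ^ (3 * T)) (𝓝[<] 1) (𝓝 0) := by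
      have : Continuous fun ρ : ℝ => 1 - ρ ^ (3 * T) := by fun_prop
      simpa using (this.tendsto 1).mono_left nhdsWithin_le_nhds
    obtain ⟨ρ, ⟨h1, h2⟩, h3⟩ := ((h.eventually (gt_mem_nhds hδ)).and
      (mem_nhdsWithin_of_mem_nhds (lt_mem_nhds (zero_lt_one' ℝ)))).and self_mem_nhdsWithin |>.exists
    exact ⟨ρ, h2, h3, h1⟩
  have main : ∀ D D' : Dataset L T, Near ρ D D' → A D → A' D' →
      (∀ t, budget (D.p t) (D.m t) ⊆ Set.Icc 0 fun _ => M) → ∀ U ∈ wellBehaved L,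
      ∃ U' ∈ wellBehaved L, leastSquaresLoss L W T U' D' ≤ leastSquaresLoss L W T U D + ε := by
    intro D D' hnear hAD hAD' hDM U hU
    -- Without existence of demand the infimum could be the default value 0 of an empty set.
    have hne : {r : ℝ | ∃ E : Dataset L T, (∀ t, E.p t = D.p t) ∧ Rationalizes U E ∧
        (∀ t, E.q t ∈ budget (D.p t) (D.m t)) ∧
        r = ∑ t, (D.q t - E.q t) ⬝ᵥ (W T D t *ᵥ (D.q t - E.q t))}.Nonempty := by
      obtain ⟨E, h1, h2, h3⟩ := exists_rationalizes_of_prices hU D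
      exact ⟨_, E, h1, h2, h3, rfl⟩
    obtain ⟨_, ⟨E, hEp, hE, hEb, rfl⟩, hlt⟩ :=
      exists_lt_of_csInf_lt hne (lt_add_of_pos_right _ (half_pos hε))
    obtain ⟨c, hc, E', hE'p, hE'q, U', hU', hrat⟩ := exists_rationalizes_rescaled hρ0 hρ1 hU hE
      (D' := D') fun t i => by rw [hEp]; exact hnear.2 t i
    have hb : ∀ t, E'.q t ∈ budget (D'.p t) (D'.m t) := by
      refine fun t => ⟨E'.bundle_nonneg t, ?_⟩
      rw [hE'q, dotProduct_smul, smul_eq_mul]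
      have h1 := mul_dotProduct_le (fun i => (hnear.2 t i).2) (E.bundle_nonneg t)
      have h2 := (hEb t).2
      have h3 := (hnear.1 t t).1
      have h4 : 0 < D'.p t ⬝ᵥ E.q t :=
        dotProduct_pos_of_ne_zero (D'.price_pos t) (E.bundle_nonneg t) (E t).1.2.2
      calc c t * (D'.p t ⬝ᵥ E.q t) ≤ ρ ^ 3 * (D'.p t ⬝ᵥ E.q t) :=
            mul_le_mul_of_nonneg_right (hc t).2 h4.le
        _ ≤ ρ ^ 2 * (D'.p t ⬝ᵥ E.q t) :=
            mul_le_mul_of_nonneg_right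
              (pow_le_pow_of_le_one hρ0.le hρ1.le (by norm_num)) h4.le
        _ = ρ * (ρ * (D'.p t ⬝ᵥ E.q t)) := by ring
        _ ≤ ρ * D.m t := mul_le_mul_of_nonneg_left (h1.trans h2) hρ0.le
        _ ≤ D'.m t := h3
    have hcC : C c := by
      refine hball ((dist_pi_lt_iff hδ).2 fun t => ?_)
      have h1 := (hc t).1
      have h2 : c t ≤ 1 := (hc t).2.trans (pow_le_one₀ hρ0.le hρ1.le)
      rw [Real.dist_eq, abs_lt, Pi.one_apply]
      constructor <;> linarith
    have hx : E.q ∈ Set.Icc (0 : Fin T → Fin L → ℝ) fun _ _ => M :=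
      ⟨fun t => (hDM t (hEb t)).1, fun t => (hDM t (hEb t)).2⟩
    have hfin := hAB hAD (hAC hAD' hcC) E.q hx
    refine ⟨U', hU', (leastSquaresLoss_le hW hE'p hrat hb).trans ?_⟩
    have hq : E'.q = fun t => c t • E.q t := funext hE'q
    have hlt' : weightedSquares W D E.q < leastSquaresLoss L W T U D + ε / 2 := hlt
    rw [hq]
    linarith
  filter_upwards [eventually_near hρ1 D₀, hA, hA', hM] with D h1 h2 h3 h4
  exact ⟨main D₀ D h1 hA.self_of_nhds h3 hM.self_of_nhds,
    main D D₀ h1.symm h2 hA'.self_of_nhds h4⟩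

/-! ### The Swaps index -/

lemma volume_hyperplane {p : Fin L → ℝ} (hp : p ≠ 0) (m : ℝ) :
    volume {x : Fin L → ℝ | p ⬝ᵥ x = m} = 0 := by
  rcases Set.eq_empty_or_nonempty {x : Fin L → ℝ | p ⬝ᵥ x = m} with h | ⟨x₀, hx₀⟩
  · simp [h]
  let K : Submodule ℝ (Fin L → ℝ) :=
    { carrier := {x | p ⬝ᵥ x = 0}
      add_mem' := fun {a b} ha hb => by
        simp only [Set.mem_ofPred_eq] at ha hb ⊢
        rw [dotProduct_add, ha, hb, add_zero]
      zero_mem' := dotProduct_zero p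
      smul_mem' := fun c x hx => by
        simp only [Set.mem_ofPred_eq] at hx ⊢
        rw [dotProduct_smul, hx, smul_zero] }
  have hK : K ≠ ⊤ := by
    intro htop
    have : p ∈ K := htop ▸ Submodule.mem_top
    exact hp (dotProduct_self_eq_zero.1 this)
  have heq : {x : Fin L → ℝ | p ⬝ᵥ x = m} = (fun x => x + -x₀) ⁻¹' (K : Set (Fin L → ℝ)) := by
    ext x
    have hx₀ : p ⬝ᵥ x₀ = m := hx₀
    change p ⬝ᵥ x = m ↔ p ⬝ᵥ (x + -x₀) = 0
    rw [← sub_eq_add_neg, dotProduct_sub, hx₀, sub_eq_zero]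
  rw [heq, measure_preimage_add_right]
  exact Measure.addHaar_submodule volume K hK

/-- The affordable bundles that dominate one of the bundles `z s` with `s ∈ S`. -/
def dominating (S : Set (Fin T)) (p : Fin L → ℝ) (m : ℝ) (z : Fin T → Fin L → ℝ) :
    Set (Fin L → ℝ) :=
  {x | x ∈ budget p m ∧ ∃ s ∈ S, z s ≤ x}

lemma measurableSet_dominating (S : Set (Fin T)) (p : Fin L → ℝ) (m : ℝ)
    (z : Fin T → Fin L → ℝ) : MeasurableSet (dominating S p m z) := by
  have h1 : MeasurableSet (budget p m) :=
    ((isClosed_le continuous_const continuous_id).inter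
      (isClosed_le (continuous_const.dotProduct continuous_id) continuous_const)).measurableSet
  have h2 : dominating S p m z = budget p m ∩ ⋃ s ∈ S, Set.Ici (z s) := by
    ext x
    simp [dominating]
  rw [h2]
  exact h1.inter (MeasurableSet.biUnion S.to_countable fun s _ => isClosed_Ici.measurableSet)

lemma eventually_le_iff_le {X : Type*} [TopologicalSpace X] {f g : X → ℝ} {a : X}
    (hf : ContinuousAt f a) (hg : ContinuousAt g a) (h : f a ≠ g a) :
    ∀ᶠ x in 𝓝 a, f x ≤ g x ↔ f a ≤ g a := by
  rcases lt_or_gt_of_ne h with h | h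
  · filter_upwards [hf.eventually_lt hg h] with x hx
    exact iff_of_true hx.le h.le
  · filter_upwards [hg.eventually_lt hf h] with x hx
    exact iff_of_false hx.not_ge h.not_ge

/-- Dominated convergence: nearby sets lie in a common box. A point off the budget hyperplane that
shares no coordinate with a `z₀ s` has locally constant membership, and the excluded points form a
null set. -/
lemma continuousAt_volume_dominating [NeZero L] (S : Set (Fin T)) {p₀ : Fin L → ℝ}
    (hp₀ : ∀ i, 0 < p₀ i) (m₀ : ℝ) (z₀ : Fin T → Fin L → ℝ) :
    ContinuousAt (fun w : (Fin L → ℝ) × ℝ × (Fin T → Fin L → ℝ) =>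
      volume.real (dominating S w.1 w.2.1 w.2.2)) (p₀, m₀, z₀) := by
  obtain ⟨M, hM⟩ : ∃ M : ℝ, ∀ i, m₀ / p₀ i < M := by
    have : ∀ᶠ M : ℝ in atTop, ∀ i, m₀ / p₀ i < M :=
      eventually_all.2 fun i => eventually_gt_atTop _
    exact this.exists
  have hfst : ∀ i, Continuous fun w : (Fin L → ℝ) × ℝ × (Fin T → Fin L → ℝ) => w.1 i :=
    fun i => by fun_prop
  have hpos : ∀ᶠ w : (Fin L → ℝ) × ℝ × (Fin T → Fin L → ℝ) in 𝓝 (p₀, m₀, z₀),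
      ∀ i, 0 < w.1 i :=
    eventually_all.2 fun i => (hfst i).continuousAt.eventually (lt_mem_nhds (hp₀ i))
  have hlt : ∀ᶠ w : (Fin L → ℝ) × ℝ × (Fin T → Fin L → ℝ) in 𝓝 (p₀, m₀, z₀),
      ∀ i, w.2.1 / w.1 i < M := by
    refine eventually_all.2 fun i => ?_
    have h : ContinuousAt (fun w : (Fin L → ℝ) × ℝ × (Fin T → Fin L → ℝ) => w.2.1 / w.1 i)
        (p₀, m₀, z₀) :=
      (continuous_fst.comp continuous_snd).continuousAt.div (hfst i).continuousAt (hp₀ i).ne'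
    exact h.eventually (gt_mem_nhds (hM i))
  have hp₀' : p₀ ≠ 0 := fun h => by simpa [h] using hp₀ 0
  have hae : ∀ᵐ x : Fin L → ℝ, p₀ ⬝ᵥ x ≠ m₀ ∧ ∀ s i, z₀ s i ≠ x i := by
    refine Filter.Eventually.and (by simpa [ae_iff] using volume_hyperplane hp₀' m₀) ?_
    refine eventually_all.2 fun s => eventually_all.2 fun i => ?_
    have hi : (Pi.single i 1 : Fin L → ℝ) ≠ 0 := by simp
    have := volume_hyperplane hi (z₀ s i)
    simp only [single_dotProduct, one_mul] at this
    rw [ae_iff]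
    convert this using 3
    simp [eq_comm]
  have htend := tendsto_measure_of_ae_tendsto_indicator (𝓝 (p₀, m₀, z₀))
    (μ := (volume : Measure (Fin L → ℝ)))
    (measurableSet_dominating S p₀ m₀ z₀)
    (As := fun w : (Fin L → ℝ) × ℝ × (Fin T → Fin L → ℝ) => dominating S w.1 w.2.1 w.2.2)
    (fun w => measurableSet_dominating S w.1 w.2.1 w.2.2)
    (B := Set.Icc 0 fun _ => M) measurableSet_Icc isCompact_Icc.measure_lt_top.ne
    (by
      filter_upwards [hpos, hlt] with w h1 h2 x hx
      exact ⟨hx.1.1, fun i => (apply_le_div_of_mem_budget h1 hx.1 i).trans (h2 i).le⟩)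
    (by
      filter_upwards [hae] with x hx
      have h1 : ∀ᶠ w : (Fin L → ℝ) × ℝ × (Fin T → Fin L → ℝ) in 𝓝 (p₀, m₀, z₀),
          w.1 ⬝ᵥ x ≤ w.2.1 ↔ p₀ ⬝ᵥ x ≤ m₀ :=
        eventually_le_iff_le (continuous_fst.dotProduct continuous_const).continuousAt
          (continuous_fst.comp continuous_snd).continuousAt hx.1
      have h2 : ∀ᶠ w : (Fin L → ℝ) × ℝ × (Fin T → Fin L → ℝ) in 𝓝 (p₀, m₀, z₀),
          ∀ s i, w.2.2 s i ≤ x i ↔ z₀ s i ≤ x i :=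
        eventually_all.2 fun s => eventually_all.2 fun i =>
          eventually_le_iff_le (f := fun w : (Fin L → ℝ) × ℝ × (Fin T → Fin L → ℝ) => w.2.2 s i)
            (g := fun _ => x i) (by fun_prop) continuousAt_const (hx.2 s i)
      filter_upwards [h1, h2] with w hw1 hw2
      simp only [dominating, budget, Set.mem_ofPred_eq, Pi.le_def, hw1, hw2])
  have hfin : volume (dominating S p₀ m₀ z₀) ≠ ⊤ :=
    ((measure_mono fun x hx => hx.1).trans_lt (isCompact_budget hp₀ m₀).measure_lt_top).ne
  exact (ENNReal.tendsto_toReal hfin).comp htend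

/-- The total volume of the affordable bundles that dominate a bundle of at least the same rank. -/
noncomputable def swapsVolume (r : Equiv.Perm (Fin T)) (D : Dataset L T) (z : Fin T → Fin L → ℝ) : ℝ :=
  ∑ t, (volume : Measure (Fin L → ℝ)).real (dominating {s | r t ≤ r s} (D.p t) (D.m t) z)

lemma continuous_volume_dominating [NeZero L] {X : Type*} [TopologicalSpace X] (S : Set (Fin T))
    {p : X → Fin L → ℝ} {m : X → ℝ} {z : X → Fin T → Fin L → ℝ} (hp : Continuous p)
    (hm : Continuous m) (hz : Continuous z) (hpos : ∀ x i, 0 < p x i) :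
    Continuous fun x => volume.real (dominating S (p x) (m x) (z x)) :=
  continuous_iff_continuousAt.2 fun x =>
    (continuousAt_volume_dominating S (hpos x) (m x) (z x)).comp_of_eq
      (f := fun x => (p x, m x, z x)) (hp.prodMk (hm.prodMk hz)).continuousAt rfl

lemma continuous_swapsVolume [NeZero L] {X : Type*} [TopologicalSpace X]
    (r : Equiv.Perm (Fin T)) {D : X → Dataset L T} {z : X → Fin T → Fin L → ℝ}
    (hD : Continuous D) (hz : Continuous z) : Continuous fun x => swapsVolume r (D x) (z x) := by
  refine continuous_finsetSum _ fun t _ => ?_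
  exact continuous_volume_dominating {s | r t ≤ r s} ((Dataset.continuous_p t).comp hD)
    ((Dataset.continuous_cost t t).comp hD) hz fun x => (D x).price_pos t

lemma volume_ne_top_of_subset_budget {p : Fin L → ℝ} (hp : ∀ i, 0 < p i) {m : ℝ}
    {A : Set (Fin L → ℝ)} (hA : A ⊆ budget p m) : volume A ≠ ⊤ :=
  ((measure_mono hA).trans_lt (isCompact_budget hp m).measure_lt_top).ne

/-- By monotonicity, anything above a bundle of at least equal rank is strictly preferred, except
possibly that bundle itself; these finitely many points are null. -/
lemma swapsVolume_le_swapsLoss [NeZero L] {U : Utility L} (hU : U ∈ wellBehaved L)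
    (D : Dataset L T) {r : Equiv.Perm (Fin T)}
    (hr : ∀ t s, r t ≤ r s → U (D.q t) ≤ U (D.q s)) :
    swapsVolume r D D.q ≤ swapsLoss L T U D := by
  refine Finset.sum_le_sum fun t _ => ?_
  set A : Set (Fin L → ℝ) := {q | q ∈ budget (D.p t) (D.m t) ∧ U (D.q t) < U q}
  have hsub : dominating {s | r t ≤ r s} (D.p t) (D.m t) D.q ⊆ A ∪ Set.range D.q := by
    rintro x ⟨hx, s, hs, hsx⟩
    by_cases h : D.q s = x
    · exact Or.inr ⟨s, h⟩
    · exact Or.inl ⟨hx, (hr t s hs).trans_lt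
        (hU.2 (D.bundle_nonneg s) hx.1 (lt_of_le_of_ne hsx h))⟩
  have hrange : volume (Set.range D.q) = 0 := (Set.finite_range D.q).measure_zero volume
  have hle : volume (dominating {s | r t ≤ r s} (D.p t) (D.m t) D.q) ≤ volume A :=
    (measure_mono hsub).trans ((measure_union_le _ _).trans (by simp [hrange]))
  exact ENNReal.toReal_mono
    (volume_ne_top_of_subset_budget (D.price_pos t) fun q hq => hq.1) hle

/-- For each ranking of the observations there is a well-behaved utility such that the bundles
preferred to a purchased bundle in its budget set nearly dominate a bundle of at least the same
rank. -/
lemma exists_wellBehaved_preferred_subset (D : Dataset L T) (r : Equiv.Perm (Fin T)) {δ : ℝ}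
    (hδ : 0 < δ) : ∃ U ∈ wellBehaved L, ∀ t,
      {q | q ∈ budget (D.p t) (D.m t) ∧ U (D.q t) < U q} ⊆
        dominating {s | r t ≤ r s} (D.p t) (D.m t) fun s i => D.q s i - δ := by
  -- Normalizes the linear term, added for strict monotonicity, to at most 1 on every budget set.
  obtain ⟨c, hc, hc0⟩ : ∃ c : ℝ, (∀ t, ∑ i, D.m t / D.p t i ≤ c) ∧ 0 < c := by
    have : ∀ᶠ c : ℝ in atTop, ∀ t, ∑ i, D.m t / D.p t i ≤ c :=
      eventually_all.2 fun t => eventually_ge_atTop _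
    exact (this.and (eventually_gt_atTop 0)).exists
  -- A continuous step: `r s + 1` above `D.q s`, and 0 at bundles that do not dominate `D.q s`
  -- lowered by `δ`. The shift by one leaves a unit gap, also above the value 0, which the linear
  -- term cannot bridge.
  let g : Fin T → (Fin L → ℝ) → NNReal := fun s x =>
    (((r s : ℕ) : NNReal) + 1) * ∏ i, min 1 (Real.toNNReal (1 + (x i - D.q s i) / δ))
  have hgc : ∀ s, Continuous (g s) := fun s => continuous_const.mul
    (continuous_finsetProd _ fun i _ => continuous_const.min
      (continuous_real_toNNReal.comp (by fun_prop)))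
  have hgm : ∀ s, Monotone (g s) := fun s x y hxy => by
    refine mul_le_mul_right (Finset.prod_le_prod (fun _ _ => zero_le) fun i _ => ?_) _
    have := hxy i
    gcongr
  have hgq : ∀ s, g s (D.q s) = ((r s : ℕ) : NNReal) + 1 := fun s => by simp [g]
  have hg1 : ∀ s x, g s x ≤ ((r s : ℕ) : NNReal) + 1 := fun s x => by
    refine mul_le_of_le_one_right (zero_le) ?_
    exact Finset.prod_le_one (fun _ _ => zero_le) fun i _ => min_le_left _ _
  have hg0 : ∀ s x, ¬ (fun i => D.q s i - δ) ≤ x → g s x = 0 := fun s x h => by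
    obtain ⟨i, hi⟩ := not_forall.1 h
    have hneg : 1 + (x i - D.q s i) / δ ≤ 0 := by
      have : (x i - D.q s i) / δ ≤ -1 := by
        rw [div_le_iff₀ hδ]
        linarith [not_le.1 hi]
      linarith
    exact mul_eq_zero_of_right _ (Finset.prod_eq_zero (Finset.mem_univ i)
      (by simp [Real.toNNReal_of_nonpos hneg]))
  refine ⟨fun x => ((Finset.univ.sup fun s => g s x : NNReal) : ℝ) + (∑ i, x i) / c,
    mem_wellBehaved_of_continuous ?_ ?_, ?_⟩
  · exact (NNReal.continuous_coe.comp (Continuous.finset_sup_apply fun s _ => hgc s)).add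
      ((continuous_finsetSum _ fun i _ => continuous_apply i).div_const c)
  · intro x y hxy
    refine add_lt_add_of_le_of_lt (NNReal.coe_le_coe.2 (Finset.sup_mono_fun fun s _ =>
      hgm s hxy.le)) (div_lt_div_of_pos_right ?_ hc0)
    obtain ⟨hle, i, hi⟩ := Pi.lt_def.1 hxy
    exact Finset.sum_lt_sum (fun j _ => hle j) ⟨i, Finset.mem_univ i, hi⟩
  · rintro t x ⟨hx, hlt⟩
    refine ⟨hx, ?_⟩
    by_contra! hno
    -- Only steps of rank below `r t` are felt at `x`, so the utility there is at most `r t + 1`,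
    -- which `D.q t` attains.
    have h1 : Finset.univ.sup (fun s => g s x) ≤ ((r t : ℕ) : NNReal) := by
      refine Finset.sup_le fun s _ => ?_
      rcases lt_or_ge (r s) (r t) with h | h
      · exact (hg1 s x).trans (by exact_mod_cast Nat.succ_le_of_lt h)
      · rw [hg0 s x (hno s h)]
        exact zero_le
    have h2 : ((r t : ℕ) : NNReal) + 1 ≤ Finset.univ.sup fun s => g s (D.q t) := by
      rw [← hgq t]
      exact Finset.le_sup (f := fun s => g s (D.q t)) (Finset.mem_univ t)
    have h3 : (∑ i, x i) / c ≤ 1 := by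
      rw [div_le_one hc0]
      exact (Finset.sum_le_sum fun i _ =>
        apply_le_div_of_mem_budget (D.price_pos t) hx i).trans (hc t)
    have h4 : 0 ≤ (∑ i, D.q t i) / c :=
      div_nonneg (Finset.sum_nonneg fun i _ => D.bundle_nonneg t i) hc0.le
    have h1' := NNReal.coe_le_coe.2 h1
    have h2' := NNReal.coe_le_coe.2 h2
    push_cast at h1' h2' hlt
    linarith

/-- Counterpart of `swapsVolume_le_swapsLoss`: the excess volume vanishes as `δ` tends to 0. -/
lemma exists_swapsLoss_le [NeZero L] (D : Dataset L T) (r : Equiv.Perm (Fin T)) {ε : ℝ}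
    (hε : 0 < ε) : ∃ U ∈ wellBehaved L, swapsLoss L T U D ≤ swapsVolume r D D.q + ε := by
  have hlim : Tendsto (fun δ : ℝ => swapsVolume r D fun s i => D.q s i - δ) (𝓝[>] 0)
      (𝓝 (swapsVolume r D D.q)) := by
    have : Continuous fun δ : ℝ => swapsVolume r D fun s i => D.q s i - δ :=
      continuous_swapsVolume r continuous_const (by fun_prop)
    simpa using (this.tendsto 0).mono_left nhdsWithin_le_nhds
  obtain ⟨δ, hlt, hδ⟩ := ((hlim.eventually (gt_mem_nhds (lt_add_of_pos_right _ hε))).and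
    self_mem_nhdsWithin).exists
  obtain ⟨U, hU, hsub⟩ := exists_wellBehaved_preferred_subset D r (Set.mem_Ioi.1 hδ)
  refine ⟨U, hU, (Finset.sum_le_sum fun t _ => ?_).trans hlt.le⟩
  exact measureReal_mono (hsub t)
    (volume_ne_top_of_subset_budget (D.price_pos t) fun q hq => hq.1)

lemma swapsLoss_nonneg (T : ℕ) (U : Utility L) (D : Dataset L T) : 0 ≤ swapsLoss L T U D :=
  Finset.sum_nonneg fun _ _ => measureReal_nonneg

lemma isGoodnessOfFit_swapsIndex :
    IsGoodnessOfFit (wellBehaved L) (swapsIndex (wellBehaved L)) := by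
  refine isGoodnessOfFit_generatedIndex swapsLoss_nonneg fun T U D hD => ?_
  refine (Finset.sum_eq_zero fun t _ => ?_).le
  have : {q | q ∈ budget (D.p t) (D.m t) ∧ U (D.q t) < U q} = ∅ :=
    Set.eq_empty_of_forall_notMem fun q hq => (hD t q hq.1).not_gt hq.2
  rw [this, measureReal_empty]

lemma isContinuous_swapsIndex [NeZero L] : IsContinuous (swapsIndex (wellBehaved L)) := by
  refine isContinuous_generatedIndex swapsLoss_nonneg fun T D₀ ε hε => ?_
  have main : ∀ D D' : Dataset L T,
      (∀ r : Equiv.Perm (Fin T), swapsVolume r D' D'.q ≤ swapsVolume r D D.q + ε / 2) →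
      ∀ U ∈ wellBehaved L, ∃ U' ∈ wellBehaved L,
        swapsLoss L T U' D' ≤ swapsLoss L T U D + ε := by
    intro D D' h U hU
    let r : Equiv.Perm (Fin T) := (Tuple.sort fun t => U (D.q t)).symm
    have hr : ∀ t s, r t ≤ r s → U (D.q t) ≤ U (D.q s) := by
      intro t s h
      simpa [r] using Tuple.monotone_sort (fun t => U (D.q t)) h
    obtain ⟨U', hU', hle⟩ := exists_swapsLoss_le D' r (half_pos hε)
    have := swapsVolume_le_swapsLoss hU D hr
    exact ⟨U', hU', by linarith [h r]⟩
  have hc : ∀ r : Equiv.Perm (Fin T), Continuous fun D : Dataset L T => swapsVolume r D D.q :=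
    fun r => continuous_swapsVolume r continuous_id
      (continuous_pi fun t => Dataset.continuous_q t)
  have hev : ∀ᶠ D in 𝓝 D₀, ∀ r : Equiv.Perm (Fin T),
      dist (swapsVolume r D D.q) (swapsVolume r D₀ D₀.q) < ε / 2 :=
    eventually_all.2 fun r => Metric.tendsto_nhds.1 (hc r).continuousAt _ (half_pos hε)
  filter_upwards [hev] with D hD
  simp only [Real.dist_eq, abs_lt] at hD
  exact ⟨main _ _ fun r => by linarith [(hD r).2], main _ _ fun r => by linarith [(hD r).1]⟩

/-! ### The Houtman-Maks index -/

lemma houtmanMaksLoss_nonneg (T : ℕ) (U : Utility L) (D : Dataset L T) :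
    0 ≤ houtmanMaksLoss L T U D :=
  Real.sInf_nonneg (by rintro _ ⟨S, -, rfl⟩; positivity)

lemma houtmanMaksLoss_of_rationalizes {U : Utility L} {D : Dataset L T}
    (h : Rationalizes U D) : houtmanMaksLoss L T U D ≤ 0 :=
  csInf_le ⟨0, by rintro _ ⟨S, -, rfl⟩; positivity⟩ ⟨∅, fun t _ => h t, by simp⟩

lemma one_le_houtmanMaksLoss {U : Utility L} {D : Dataset L T} (h : ¬ Rationalizes U D) :
    1 ≤ houtmanMaksLoss L T U D := by
  -- Removing every observation is always admissible, so the infimum is not over an empty set.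
  refine le_csInf ⟨_, Finset.univ, fun t ht => absurd (Finset.mem_univ t) ht, rfl⟩ ?_
  rintro _ ⟨S, hS, rfl⟩
  have : S.Nonempty := by
    by_contra hne
    rw [Finset.not_nonempty_iff_eq_empty] at hne
    exact h fun t => hS t (by simp [hne])
  exact_mod_cast this.card_pos

lemma isGoodnessOfFit_houtmanMaksIndex :
    IsGoodnessOfFit (wellBehaved L) (houtmanMaksIndex (wellBehaved L)) :=
  isGoodnessOfFit_generatedIndex houtmanMaksLoss_nonneg fun _ _ _ =>
    houtmanMaksLoss_of_rationalizes

lemma one_le_houtmanMaksIndex {D : Dataset L T}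
    (h : ¬ ∃ U ∈ wellBehaved L, Rationalizes U D) :
    1 ≤ houtmanMaksIndex (wellBehaved L) T D :=
  le_ciInf fun U => one_le_houtmanMaksLoss fun hU => h ⟨U.1, U.2, hU⟩

lemma isAccurate_houtmanMaksIndex :
    IsAccurate (wellBehaved L) (houtmanMaksIndex (wellBehaved L)) := by
  refine fun T D => ⟨fun h0 => ?_, isGoodnessOfFit_houtmanMaksIndex.2 T D⟩
  by_contra h
  linarith [one_le_houtmanMaksIndex h]

/-! ### Two curves of datasets -/

/-- A violation of the weak axiom of revealed preference excludes rationalizability. -/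
lemma not_exists_rationalizes [NeZero L] {D : Dataset L T} {t s : Fin T}
    (h1 : D.p t ⬝ᵥ D.q s ≤ D.m t) (h2 : D.p s ⬝ᵥ D.q t < D.m s) :
    ¬ ∃ U ∈ wellBehaved L, Rationalizes U D := by
  rintro ⟨U, hU, hD⟩
  exact (lt_of_cost_lt hU (hD s) (D.bundle_nonneg t) h2).not_ge
    (hD t _ ⟨D.bundle_nonneg s, h1⟩)

/-- The dataset of two observations with given bundles and prices. -/
def pairDataset (x y : Bundle L) (p p' : Price L) : Dataset L 2 := ![(x, p), (y, p')]

lemma continuous_pairDataset {X : Type*} [TopologicalSpace X] {x y : X → Bundle L}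
    {p p' : Price L} (hx : Continuous x) (hy : Continuous y) :
    Continuous fun a => pairDataset (x a) (y a) p p' := by
  refine continuous_pi fun t => ?_
  fin_cases t
  · exact hx.prodMk continuous_const
  · exact hy.prodMk continuous_const

lemma exists_rationalizes_pairDataset {x y : Bundle L} {p p' : Price L} {u v : ℝ}
    (h1 : p.1 ⬝ᵥ y.1 ≤ p.1 ⬝ᵥ x.1 → v ≤ u) (h1' : p.1 ⬝ᵥ y.1 < p.1 ⬝ᵥ x.1 → v < u)
    (h2 : p'.1 ⬝ᵥ x.1 ≤ p'.1 ⬝ᵥ y.1 → u ≤ v) (h2' : p'.1 ⬝ᵥ x.1 < p'.1 ⬝ᵥ y.1 → u < v) :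
    ∃ U ∈ wellBehaved L, Rationalizes U (pairDataset x y p p') := by
  refine exists_rationalizes_of_levels _ ![u, v] (fun t s => ?_) fun t s => ?_
  · fin_cases t <;> fin_cases s
    · exact fun _ => le_rfl
    · exact h1
    · exact h2
    · exact fun _ => le_rfl
  · fin_cases t <;> fin_cases s
    · exact fun h => absurd h (lt_irrefl _)
    · exact h1'
    · exact h2'
    · exact fun h => absurd h (lt_irrefl _)

/-- The price vector with price `2` for the good `i` and price `1` for all other goods. -/
def doubledPrice (i : Fin L) : Price L :=
  ⟨1 + Pi.single i 1, fun j => add_pos_of_pos_of_nonneg one_pos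
    ((Pi.single_nonneg.2 zero_le_one : (0 : Fin L → ℝ) ≤ Pi.single i 1) j)⟩

/-- The bundle of `1 + |a|` units of the good `i`. -/
def singleBundle (i : Fin L) (a : ℝ) : Bundle L :=
  ⟨Pi.single i (1 + |a|), Pi.single_nonneg.2 (by positivity), by
    rw [Ne, Pi.single_eq_zero_iff]
    positivity⟩

lemma continuous_singleBundle (i : Fin L) : Continuous (singleBundle i) :=
  Continuous.subtype_mk ((continuous_single i).comp (by fun_prop)) _

/-- The bundle of one unit of each good and additional `|a|` units of the good `i`. -/
def raisedBundle (i : Fin L) (a : ℝ) : Bundle L :=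
  ⟨1 + Pi.single i |a|, add_nonneg zero_le_one (Pi.single_nonneg.2 (abs_nonneg a)), fun h => by
    have := congrFun h i
    simp only [Pi.add_apply, Pi.one_apply, Pi.single_eq_same, Pi.zero_apply] at this
    linarith [abs_nonneg a]⟩

lemma continuous_raisedBundle (i : Fin L) : Continuous (raisedBundle i) :=
  Continuous.subtype_mk (continuous_const.add ((continuous_single i).comp (by fun_prop))) _

/-- A continuous goodness-of-fit index is not accurate: it vanishes on the closure of the
rationalizable datasets. -/
theorem not_isAccurate_of_isContinuous (hL : 2 ≤ L) {τ : Index L}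
    (hfit : IsGoodnessOfFit (wellBehaved L) τ) (hcont : IsContinuous τ) :
    ¬ IsAccurate (wellBehaved L) τ := by
  intro hacc
  have : NeZero L := ⟨by omega⟩
  let i : Fin L := ⟨0, by omega⟩
  let j : Fin L := ⟨1, by omega⟩
  have hij : i ≠ j := by simp [i, j]
  let p : Price L := ⟨1, fun _ => one_pos⟩
  -- For `a ≠ 0` the second bundle costs `1 + |a|` at unit prices, more than the first expenditure
  -- of 1, so only the second choice reveals a preference. At `a = 0` it becomes just affordable and
  -- closes the cycle.
  let D : ℝ → Dataset L 2 := fun a =>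
    pairDataset (singleBundle i 0) (singleBundle j a) p (doubledPrice j)
  have hcost : ∀ a k, p.1 ⬝ᵥ (singleBundle k a).1 = 1 + |a| := fun a k => by
    simp [p, singleBundle]
  have hcosti : (doubledPrice j).1 ⬝ᵥ (singleBundle i 0).1 = 1 := by
    simp [doubledPrice, singleBundle, hij]
  have hcostj : ∀ a, (doubledPrice j).1 ⬝ᵥ (singleBundle j a).1 = 2 * (1 + |a|) := fun a => by
    simp [doubledPrice, singleBundle]
    norm_num
  have hD : Continuous D :=
    continuous_pairDataset continuous_const (continuous_singleBundle j)
  have hzero : ∀ a ≠ 0, τ 2 (D a) = 0 := by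
    intro a ha
    have ha' := abs_pos.2 ha
    refine hfit.2 2 _ (exists_rationalizes_pairDataset (u := 0) (v := 1) ?_ ?_ ?_ ?_)
    · rw [hcost, hcost, abs_zero]
      intro h
      linarith
    · rw [hcost, hcost, abs_zero]
      intro h
      linarith
    · exact fun _ => zero_le_one
    · exact fun _ => zero_lt_one
  have hall : (fun a => τ 2 (D a)) = fun _ => 0 :=
    Continuous.ext_on (dense_compl_singleton (0 : ℝ)) ((hcont 2).comp hD) continuous_const hzero
  refine not_exists_rationalizes (D := D 0) (t := 0) (s := 1) ?_ ?_
    ((hacc 2 _).1 (congrFun hall 0))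
  · exact ((hcost 0 j).trans (hcost 0 i).symm).le
  · change (doubledPrice j).1 ⬝ᵥ (singleBundle i 0).1 < (doubledPrice j).1 ⬝ᵥ (singleBundle j 0).1
    rw [hcosti, hcostj]
    norm_num

theorem not_isContinuous_houtmanMaksIndex (hL : 2 ≤ L) :
    ¬ IsContinuous (houtmanMaksIndex (wellBehaved L)) := by
  intro hcont
  have : NeZero L := ⟨by omega⟩
  let i : Fin L := ⟨0, by omega⟩
  let j : Fin L := ⟨1, by omega⟩
  have hij : i ≠ j := by simp [i, j]
  -- Each observation doubles the price of the good it buys more of. For `a ≠ 0` the other bundle is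
  -- cheaper by `|a|`, a violation both ways; at `a = 0` the two bundles coincide.
  let D : ℝ → Dataset L 2 := fun a =>
    pairDataset (raisedBundle i a) (raisedBundle j a) (doubledPrice i) (doubledPrice j)
  have hcost : ∀ (a : ℝ) (k l : Fin L), (doubledPrice k).1 ⬝ᵥ (raisedBundle l a).1 =
      (doubledPrice k).1 ⬝ᵥ 1 + (doubledPrice k).1 l * |a| := fun a k l => by
    simp only [raisedBundle, dotProduct_add, dotProduct_single]
  have hsame : ∀ k : Fin L, (doubledPrice k).1 k = 2 := fun k => by
    simp only [doubledPrice, Pi.add_apply, Pi.one_apply, Pi.single_eq_same]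
    norm_num
  have hother : ∀ k l : Fin L, l ≠ k → (doubledPrice k).1 l = 1 := fun k l h => by
    simp [doubledPrice, h]
  have hD : Continuous D :=
    continuous_pairDataset (continuous_raisedBundle i) (continuous_raisedBundle j)
  have hone : ∀ a ∈ ({0}ᶜ : Set ℝ), 1 ≤ houtmanMaksIndex (wellBehaved L) 2 (D a) := by
    intro a ha
    have ha' : 0 < |a| := abs_pos.2 ha
    refine one_le_houtmanMaksIndex (not_exists_rationalizes (t := 0) (s := 1) ?_ ?_)
    · change (doubledPrice i).1 ⬝ᵥ (raisedBundle j a).1 ≤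
        (doubledPrice i).1 ⬝ᵥ (raisedBundle i a).1
      rw [hcost, hcost, hsame, hother i j hij.symm]
      linarith
    · change (doubledPrice j).1 ⬝ᵥ (raisedBundle i a).1 <
        (doubledPrice j).1 ⬝ᵥ (raisedBundle j a).1
      rw [hcost, hcost, hsame, hother j i hij]
      linarith
  have h0 : houtmanMaksIndex (wellBehaved L) 2 (D 0) = 0 := by
    have heq : ∀ k : Fin L, (doubledPrice k).1 ⬝ᵥ (raisedBundle i 0).1 =
        (doubledPrice k).1 ⬝ᵥ (raisedBundle j 0).1 := fun k => by simp [hcost]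
    refine isGoodnessOfFit_houtmanMaksIndex.2 2 _
      (exists_rationalizes_pairDataset (u := 0) (v := 0) ?_ ?_ ?_ ?_)
    · exact fun _ => le_rfl
    · exact fun h => absurd (heq i).symm h.ne
    · exact fun _ => le_rfl
    · exact fun h => absurd (heq j) h.ne
  have hclosed : IsClosed {a | 1 ≤ houtmanMaksIndex (wellBehaved L) 2 (D a)} :=
    isClosed_le continuous_const ((hcont 2).comp hD)
  have hmem := hclosed.closure_subset_iff.2 hone (dense_compl_singleton (0 : ℝ) 0)
  have : (1 : ℝ) ≤ houtmanMaksIndex (wellBehaved L) 2 (D 0) := hmem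
  linarith

end RevealedPreference

theorem proposition5 (L : ℕ) (hL : 2 ≤ L) :
    (IsGoodnessOfFit (wellBehaved L) (afriatIndex (wellBehaved L)) ∧
      IsContinuous (afriatIndex (wellBehaved L)) ∧
      ¬ IsAccurate (wellBehaved L) (afriatIndex (wellBehaved L))) ∧
    (∀ f : ∀ T : ℕ, (Fin T → ℝ) → ℝ, IsAggregator f →
      IsGoodnessOfFit (wellBehaved L) (varianIndex f (wellBehaved L)) ∧
      IsContinuous (varianIndex f (wellBehaved L)) ∧
      ¬ IsAccurate (wellBehaved L) (varianIndex f (wellBehaved L))) ∧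
    (IsGoodnessOfFit (wellBehaved L) (swapsIndex (wellBehaved L)) ∧
      IsContinuous (swapsIndex (wellBehaved L)) ∧
      ¬ IsAccurate (wellBehaved L) (swapsIndex (wellBehaved L))) ∧
    (∀ W : ∀ T : ℕ, Dataset L T → Fin T → Matrix (Fin L) (Fin L) ℝ, IsWeighting W →
      IsGoodnessOfFit (wellBehaved L) (leastSquaresIndex W (wellBehaved L)) ∧
      IsContinuous (leastSquaresIndex W (wellBehaved L)) ∧
      ¬ IsAccurate (wellBehaved L) (leastSquaresIndex W (wellBehaved L))) ∧
    (IsGoodnessOfFit (wellBehaved L) (houtmanMaksIndex (wellBehaved L)) ∧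
      IsAccurate (wellBehaved L) (houtmanMaksIndex (wellBehaved L)) ∧
      ¬ IsContinuous (houtmanMaksIndex (wellBehaved L))) := by
  have : NeZero L := ⟨by omega⟩
  refine ⟨⟨isGoodnessOfFit_afriatIndex, isContinuous_afriatIndex,
      not_isAccurate_of_isContinuous hL isGoodnessOfFit_afriatIndex isContinuous_afriatIndex⟩,
    fun f hf => ⟨isGoodnessOfFit_varianIndex hf, isContinuous_varianIndex hf,
      not_isAccurate_of_isContinuous hL (isGoodnessOfFit_varianIndex hf)
        (isContinuous_varianIndex hf)⟩,
    ⟨isGoodnessOfFit_swapsIndex, isContinuous_swapsIndex,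
      not_isAccurate_of_isContinuous hL isGoodnessOfFit_swapsIndex isContinuous_swapsIndex⟩,
    fun W hW => ⟨isGoodnessOfFit_leastSquaresIndex hW, isContinuous_leastSquaresIndex hW,
      not_isAccurate_of_isContinuous hL (isGoodnessOfFit_leastSquaresIndex hW)
        (isContinuous_leastSquaresIndex hW)⟩,
    isGoodnessOfFit_houtmanMaksIndex, isAccurate_houtmanMaksIndex,
    not_isContinuous_houtmanMaksIndex hL⟩
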